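/- Let $\Phi$ be a stationary point process on $\mathbb{R}^2$, defined on a probability space $(\Omega,\mathcal{A},\mathbb{P})$ and modelling the locations of base stations (BSs). Let $H>0$ and suppose that $\Phi$ is $H$-hardcore regulated: almost surely, any two distinct points of $\Phi$ are at Euclidean distance at least $2H$. Let $P>0$ be the transmit power of the BSs, $W>0$ the noise power, $\ell\colon[0,\infty)\to[0,\infty)$ a (bounded) non-increasing attenuation function, and $K\ge 1$ the number of slots in a period. A user at the origin is served by a closest BS $x_0\in\operatorname{argmin}\{\|x\|\colon x\in\Phi\}$, and $d=\|x_0\|$. All BSs are active in all slots, so that for $i=1,\dots,K$ the signal-to-interference-plus-noise ratio of the user in slot $i$ is $$\mathrm{SINR}_i=\frac{P\,\ell(d)}{P\sum_{x\in\Phi\setminus\{x_0\}}\ell(\|x\|)+W},$$ and its normalized rate is $R=\frac1K\sum_{i=1}^K\log(1+\mathrm{SINR}_i)$. Put $t=\max(d,2H-d)$ and $$\theta(P,H)=\frac{P\,\ell(d)}{P\displaystyle\int_t^\infty\frac{2\pi\,\ell(r)}{\sqrt{12}}\Big(\frac1H+\frac{r}{H^2}\Big)\,dr+P\,\frac{\pi\,\ell(t)\,t}{\sqrt{12}}\Big(\frac2H+\frac{t}{H^2}\Big)+W}$$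 (sums and integrals of non-negative terms are taken in $[0,\infty]$, and a quotient with infinite denominator is $0$). Then, given $\|x_0\|=d$, $\mathbb{P}$-almost surely $$\mathrm{SINR}_i\ge\theta(P,H)\quad\text{for all } i\in\{1,\dots,K\},\qquad\text{and}\qquad R\ge\log\big(1+\theta(P,H)\big).$$ -/

import Mathlib

open MeasureTheory Set
open scoped ENNReal

noncomputable section

namespace CellularNetwork

/-- The Euclidean plane. -/
abbrev Plane : Type := EuclideanSpace ℝ (Fin 2)

/-- A (simple) point process on the plane, defined on the measurable space `Ω`: a random locally
finite set of points whose counting measure is a random measure, i.e. the number of points in every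
Borel set is a measurable function of `ω`. -/
structure PointProcess (Ω : Type*) [MeasurableSpace Ω] where
  /-- The set of points of the realization `ω`. -/
  points : Ω → Set Plane
  /-- Every bounded region contains finitely many points. -/
  locallyFinite : ∀ ω : Ω, ∀ r : ℝ, (points ω ∩ Metric.closedBall 0 r).Finite
  /-- The counting measure is a measurable function of `ω`. -/
  measurable_count : Measurable fun ω => (Measure.count : Measure Plane).restrict (points ω)

namespace PointProcess

variable {Ω : Type*} [MeasurableSpace Ω]

/-- The random counting measure `B ↦ #(Φ ∩ B)` of the point process. -/
def toMeasure (Φ : PointProcess Ω) (ω : Ω) : Measure Plane :=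
  (Measure.count : Measure Plane).restrict (Φ.points ω)

/-- Stationarity: every translate of the process has the same law as the process itself. -/
def IsStationary (Φ : PointProcess Ω) (μ : Measure Ω) : Prop :=
  ∀ v : Plane,
    μ.map (fun ω => (Φ.toMeasure ω).map (fun x => x + v)) = μ.map (fun ω => Φ.toMeasure ω)

/-- `H`-hardcore regulation: the process is stationary and, almost surely, any two distinct points
are at distance at least `2 * H`. -/
def IsHardcoreRegulated (Φ : PointProcess Ω) (μ : Measure Ω) (H : ℝ) : Prop :=
  Φ.IsStationary μ ∧
    ∀ᵐ ω ∂μ, ∀ x ∈ Φ.points ω, ∀ y ∈ Φ.points ω, x ≠ y → 2 * H ≤ ‖x - y‖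

end PointProcess

/-- `x₀` is a serving base station of the user at the origin: a point of the configuration `S`
that is closest to the origin. -/
def IsServing (S : Set Plane) (x₀ : Plane) : Prop :=
  x₀ ∈ S ∧ ∀ x ∈ S, ‖x₀‖ ≤ ‖x‖

/-- Total attenuation `∑ ℓ(‖x‖)` from the base stations in `A` other than `x₀` to the origin,
as a number in `[0, ∞]`. -/
def interference (ℓ : ℝ → ℝ) (A : Set Plane) (x₀ : Plane) : ℝ≥0∞ :=
  ∑' x : (A \ {x₀} : Set Plane), ENNReal.ofReal (ℓ ‖(x : Plane)‖)

open Classical in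
/-- SINR, in a slot in which `A` is the set of active base stations, of the user at the origin
served by `x₀`, with transmit power `P`, noise power `W` and attenuation `ℓ`. It is `0` if `x₀` is
muted, and also if the interference is infinite. -/
def slotSINR (P W : ℝ) (ℓ : ℝ → ℝ) (A : Set Plane) (x₀ : Plane) : ℝ :=
  if x₀ ∈ A then
    (ENNReal.ofReal (P * ℓ ‖x₀‖) /
      (ENNReal.ofReal P * interference ℓ A x₀ + ENNReal.ofReal W)).toReal
  else 0

/-- The always active scheme over a period of `K` slots: in every slot the set of active base
stations is the whole configuration. -/
def alwaysActive (K : ℕ) (S : Set Plane) : Fin K → Set Plane := fun _ => S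

/-- Normalized rate of the user at the origin served by `x₀`, over a period of `K` slots in which
`A i` is the set of base stations active in slot `i`. -/
def normalizedRate {K : ℕ} (P W : ℝ) (ℓ : ℝ → ℝ) (A : Fin K → Set Plane) (x₀ : Plane) : ℝ :=
  (1 / (K : ℝ)) * ∑ i : Fin K, Real.log (1 + slotSINR P W ℓ (A i) x₀)

/-- Radius of a ball around the origin that is free of interferers:
`t = max (d, 2H - d)`. -/
def exclusionRadius (H d : ℝ) : ℝ := max d (2 * H - d)

/-- The interference bound
`∫_t^∞ (2πℓ(r)/√12) (1/H + r/H²) dr + (πℓ(t)t/√12) (2/H + t/H²)`, as a number in `[0, ∞]`. -/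
def interferenceBound (ℓ : ℝ → ℝ) (H t : ℝ) : ℝ≥0∞ :=
  (∫⁻ r in Ioi t, ENNReal.ofReal
      (2 * Real.pi * ℓ r / Real.sqrt 12 * (1 / H + r / H ^ 2))) +
    ENNReal.ofReal (Real.pi * ℓ t * t / Real.sqrt 12 * (2 / H + t / H ^ 2))

/-- The guaranteed SINR `θ(P, H)`, for noise power `W`, attenuation `ℓ` and distance `d` to the
serving base station. It is `0` if the integral in the denominator diverges. -/
def theta (P W : ℝ) (ℓ : ℝ → ℝ) (H d : ℝ) : ℝ :=
  (ENNReal.ofReal (P * ℓ d) /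
    (ENNReal.ofReal P * interferenceBound ℓ H (exclusionRadius H d) + ENNReal.ofReal W)).toReal

end CellularNetwork

end

/-!
The interference is a sum of a non-increasing function of the distances of the interferers, all of
which are at least `t = max (d, 2H - d)`. By summation by parts (`sum_antitone_le_integral`) it is
at most the stated bound once the number of interferers in the disc of radius `b` is at most
`M b = π/√12 (2b/H + b²/H²)`, because the weight in the integral is `M'` and the boundary term is
`ℓ t * M t`. The noise is positive, so a bound on the interference is a bound on the SINR.

The counting bound is a form of Thue's theorem with an explicit boundary term. Scale to `H = 1`
and take a finite `2`-separated set in the disc of radius `r ≥ 1`. Clip the Voronoi cell of each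
point by the disc of radius `R = 2/√3` about the point and by the disc `D` about the origin of
squared radius `(r + 1)² + 1/12`. Every clipped cell has area at least `2√3 = √12`
(`volume_clippedCell_ge`), the area of the hexagon of inradius `1`; comparing with the area of `D`
and using `π * 13/12 ≤ √12` gives the count (`card_le_of_separated`).

For the area of a cell, consider the caps that the bisectors and the boundary of `D` cut off from
the disc of radius `R` about the point. The sectors over these caps are disjoint: three points at
mutual distance `2` do not fit in the open disc of radius `R` about any point
(`no_three_within_circumradius`), and near the boundary of `D` all neighbours lie inwards
(`disjoint_boundarySector`). So it is enough that in each sector the cap leaves at least the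
fraction `3√3/(2π)`, the ratio of the hexagon to its circumscribed disc. For a bisector this is the
monotonicity of `sin x / x`, since the half-angle is at most `π/6`. For the boundary of `D` the
half-angle can be slightly larger, but an arc of `D` bulges beyond its chord; a parabola inscribed
in the arc already has enough area (`hexagonDensity_mul_arccos_le_of_curved`).
-/

namespace CellularNetwork

/-! ### Three separated points -/

/-- Three points at mutual distance at least `2` are not all within the circumradius `2 / √3` of
a common point, if two of them are strictly within it. Some two of the three directions from that
point enclose an angle of at most `120°`, and the law of cosines makes those two points too
close. -/
theorem no_three_within_circumradius {E : Type*} [NormedAddCommGroup E] [InnerProductSpace ℝ E]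
    {a b c : E} (ha : ‖a‖ ^ 2 ≤ 4 / 3) (hb : ‖b‖ ^ 2 < 4 / 3) (hc : ‖c‖ ^ 2 < 4 / 3)
    (hab : 2 ≤ ‖a - b‖) (hac : 2 ≤ ‖a - c‖) (hbc : 2 ≤ ‖b - c‖) : False := by
  have key : ∀ u v : E, ‖u‖ ^ 2 ≤ 4 / 3 → ‖v‖ ^ 2 < 4 / 3 → 2 ≤ ‖u - v‖ →
      inner ℝ u v < -(‖u‖ * ‖v‖) / 2 := by
    intro u v hu hv huv
    have h1 := norm_sub_sq_real u v
    nlinarith [sq_nonneg (‖u‖ - ‖v‖)]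
  have pos : ∀ u v : E, ‖u‖ ^ 2 ≤ 4 / 3 → 2 ≤ ‖u - v‖ → ‖v‖ ^ 2 ≤ 4 / 3 → 0 < ‖u‖ := by
    intro u v hu huv hv
    rcases (norm_nonneg u).eq_or_lt with h | h
    · have : u = 0 := norm_eq_zero.mp h.symm
      subst this
      rw [zero_sub, norm_neg] at huv
      nlinarith
    · exact h
  have hA := pos a b ha hab hb.le
  have hB := pos b c hb.le hbc hc.le
  have hC := pos c b hc.le (by rwa [norm_sub_rev]) hb.le
  have k1 := key a b ha hb hab
  have k2 := key a c ha hc hac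
  have k3 := key b c hb.le hc hbc
  -- The three unit vectors sum to a vector of nonnegative squared norm.
  have h0 : 0 ≤ ‖(‖b‖ * ‖c‖) • a + (‖a‖ * ‖c‖) • b + (‖a‖ * ‖b‖) • c‖ ^ 2 := sq_nonneg _
  rw [norm_add_sq_real, norm_add_sq_real] at h0
  simp only [inner_add_left, inner_smul_left, inner_smul_right, norm_smul, norm_mul, norm_norm,
    conj_trivial] at h0
  have m1 := mul_lt_mul_of_pos_left k1 (by positivity : 0 < ‖c‖ ^ 2 * ‖a‖ * ‖b‖)
  have m2 := mul_lt_mul_of_pos_left k2 (by positivity : 0 < ‖b‖ ^ 2 * ‖a‖ * ‖c‖)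
  have m3 := mul_lt_mul_of_pos_left k3 (by positivity : 0 < ‖a‖ ^ 2 * ‖b‖ * ‖c‖)
  nlinarith

/-! ### Areas of sectors and parabolic caps -/

/-- Area bound for a sector of half-angle `arccos c`, in polar coordinates. -/
theorem volume_sector_le {R : ℝ} (c : ℝ) (hR : 0 < R) :
    volume {v : ℂ | ‖v‖ < R ∧ c * ‖v‖ < v.re} ≤ ENNReal.ofReal (Real.arccos c * R ^ 2) := by
  have hm : MeasurableSet {v : ℂ | ‖v‖ < R ∧ c * ‖v‖ < v.re} := by
    exact (measurableSet_lt measurable_norm measurable_const).inter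
      (measurableSet_lt (measurable_norm.const_mul c) Complex.measurable_re)
  have hα := Real.arccos_nonneg c
  rw [← lintegral_indicator_one hm, ← Complex.lintegral_comp_polarCoord_symm]
  have hsub : ∀ p ∈ polarCoord.target,
      ENNReal.ofReal p.1 • ({v : ℂ | ‖v‖ < R ∧ c * ‖v‖ < v.re}.indicator 1
        (Complex.polarCoord.symm p) : ℝ≥0∞) ≤
      (Ioo 0 R).indicator (fun ρ => ENNReal.ofReal ρ) p.1 *
        (Icc (-Real.arccos c) (Real.arccos c)).indicator 1 p.2 := by
    intro p hp
    rw [polarCoord_target] at hp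
    obtain ⟨hp1, hp2⟩ := hp
    have hp1 : 0 < p.1 := hp1
    by_cases hv : Complex.polarCoord.symm p ∈ {v : ℂ | ‖v‖ < R ∧ c * ‖v‖ < v.re}
    · have hv' := hv
      obtain ⟨h1, h2⟩ := hv'
      rw [Complex.norm_polarCoord_symm, abs_of_pos hp1] at h1 h2
      have h3 : (Complex.polarCoord.symm p).re = p.1 * Real.cos p.2 := by
        rw [Complex.polarCoord_symm_apply, Complex.re_ofReal_mul]; simp [Complex.cos_ofReal_re]
      rw [h3, mul_comm] at h2
      have h4 : c < Real.cos p.2 := lt_of_mul_lt_mul_left h2 hp1.le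
      have h5 : |p.2| ≤ Real.arccos c := by
        rw [← Real.arccos_cos (abs_nonneg p.2) (abs_le.mpr ⟨hp2.1.le, hp2.2.le⟩), Real.cos_abs]
        exact Real.arccos_le_arccos h4.le
      rw [indicator_of_mem hv, indicator_of_mem (show p.1 ∈ Ioo 0 R from ⟨hp1, h1⟩),
        indicator_of_mem (show p.2 ∈ Icc (-Real.arccos c) (Real.arccos c) from abs_le.mp h5)]
      simp
    · rw [indicator_of_notMem hv]; simp
  calc _ ≤ ∫⁻ p in polarCoord.target, (Ioo 0 R).indicator (fun ρ => ENNReal.ofReal ρ) p.1 *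
        (Icc (-Real.arccos c) (Real.arccos c)).indicator 1 p.2 :=
        setLIntegral_mono' (polarCoord.open_target.measurableSet) hsub
    _ ≤ ∫⁻ p : ℝ × ℝ, (Ioo 0 R).indicator (fun ρ => ENNReal.ofReal ρ) p.1 *
        (Icc (-Real.arccos c) (Real.arccos c)).indicator 1 p.2 := setLIntegral_le_lintegral _ _
    _ = (∫⁻ ρ, (Ioo 0 R).indicator (fun ρ => ENNReal.ofReal ρ) ρ) *
        ∫⁻ t : ℝ, (Icc (-Real.arccos c) (Real.arccos c)).indicator 1 t := by
        rw [Measure.volume_eq_prod]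
        exact lintegral_prod_mul
          ((ENNReal.measurable_ofReal.indicator measurableSet_Ioo).aemeasurable)
          ((measurable_one.indicator measurableSet_Icc).aemeasurable)
    _ = ENNReal.ofReal (R ^ 2 / 2) * ENNReal.ofReal (2 * Real.arccos c) := by
        rw [lintegral_indicator measurableSet_Ioo, lintegral_indicator_one measurableSet_Icc,
          Real.volume_Icc, ← ofReal_integral_eq_lintegral_ofReal]
        · congr 2
          · rw [← integral_Ioc_eq_integral_Ioo, ← intervalIntegral.integral_of_le hR.le]
            simp
          · ring
        · exact (continuous_id.integrableOn_Icc (a := 0) (b := R)).mono_set Ioo_subset_Icc_self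
        · exact (ae_restrict_iff' measurableSet_Ioo).mpr (ae_of_all _ fun ρ h => h.1.le)
    _ = _ := by rw [← ENNReal.ofReal_mul (by positivity)]; congr 1; ring

/-- Area of the region between the two segments that join the origin to `h ± w i` and the parabola
through `h ± w i` with vertex `δ`. For `δ = h` it is a triangle. -/
theorem volume_parabolic_cap {w h δ : ℝ} (hw : 0 < w) (hh : 0 ≤ h) (hδ : h ≤ δ) :
    volume {v : ℂ | |v.im| < w ∧ |v.im| * (h / w) < v.re ∧
      v.re < δ - (δ - h) * (v.im / w) ^ 2} = ENNReal.ofReal (w * (4 * δ - h) / 3) := by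
  have hset : {v : ℂ | |v.im| < w ∧ |v.im| * (h / w) < v.re ∧
      v.re < δ - (δ - h) * (v.im / w) ^ 2} =
      Complex.measurableEquivRealProd ⁻¹' (Prod.swap ⁻¹' (regionBetween
        (fun z => |z| * (h / w)) (fun z => δ - (δ - h) * (z / w) ^ 2) (Ioo (-w) w))) := by
    ext v
    simp [regionBetween, Complex.measurableEquivRealProd_apply, abs_lt]
  have hf : Continuous fun z : ℝ => |z| * (h / w) := by fun_prop
  have hg : Continuous fun z : ℝ => δ - (δ - h) * (z / w) ^ 2 := by fun_prop
  have hrm := measurableSet_regionBetween hf.measurable hg.measurable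
    (measurableSet_Ioo (a := -w) (b := w))
  have hint : ∀ {u : ℝ → ℝ}, Continuous u → IntegrableOn u (Ioo (-w) w) := fun hu =>
    (hu.integrableOn_Icc (a := -w) (b := w)).mono_set Ioo_subset_Icc_self
  rw [hset, Complex.volume_preserving_equiv_real_prod.measure_preimage
    (measurable_swap hrm).nullMeasurableSet, Measure.volume_eq_prod,
    Measure.measurePreserving_swap.measure_preimage hrm.nullMeasurableSet,
    volume_regionBetween_eq_integral (hint hf) (hint hg) measurableSet_Ioo]
  · congr 1
    rw [← integral_Ioc_eq_integral_Ioo, ← intervalIntegral.integral_of_le (by linarith)]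
    have hI : ∀ {u : ℝ → ℝ}, Continuous u → ∀ a b : ℝ, IntervalIntegrable u volume a b :=
      fun hu a b => hu.intervalIntegrable a b
    have h1 : ∫ z in (-w)..w, |z| = w ^ 2 := by
      rw [← intervalIntegral.integral_add_adjacent_intervals
        (hI continuous_abs (-w) 0) (hI continuous_abs 0 w)]
      have e1 : ∫ z in (-w)..0, |z| = ∫ z in (-w)..0, -z := by
        apply intervalIntegral.integral_congr
        intro z hz
        rw [uIcc_of_le (by linarith)] at hz
        exact abs_of_nonpos hz.2
      have e2 : ∫ z in (0:ℝ)..w, |z| = ∫ z in (0:ℝ)..w, z := by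
        apply intervalIntegral.integral_congr
        intro z hz
        rw [uIcc_of_le hw.le] at hz
        exact abs_of_nonneg hz.1
      rw [e1, e2, intervalIntegral.integral_neg, integral_id, integral_id]
      ring
    simp only [Pi.sub_apply]
    rw [intervalIntegral.integral_sub (hI hg _ _) (hI hf _ _),
      intervalIntegral.integral_sub (hI continuous_const _ _) (hI (by fun_prop) _ _),
      intervalIntegral.integral_mul_const, h1]
    simp only [div_pow, intervalIntegral.integral_const_mul, intervalIntegral.integral_div,
      integral_pow, intervalIntegral.integral_const, smul_eq_mul]
    field_simp
    ring
  · intro z hz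
    have h1 : |z / w| < 1 := by
      rw [abs_div, abs_of_pos hw, div_lt_one hw]; exact abs_lt.mpr hz
    have h2 : |z| * (h / w) = |z / w| * h := by rw [abs_div, abs_of_pos hw]; ring
    simp only [h2]
    rw [← sq_abs (z / w)]
    have := abs_nonneg (z / w)
    nlinarith [mul_nonneg (sub_nonneg.mpr h1.le) (sub_nonneg.mpr hδ),
      mul_nonneg (mul_nonneg (sub_nonneg.mpr h1.le) this) (sub_nonneg.mpr hδ),
      mul_nonneg (sub_nonneg.mpr h1.le) hh]


/-- The open sector of the disc of radius `R` about the origin that is symmetric about the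
direction `e` (a unit vector) and has half-angle `arccos c`. The apex is left out. -/
def sector (R c : ℝ) (e : ℂ) : Set ℂ := {v | ‖v‖ < R ∧ c * ‖v‖ < inner ℝ e v}

/-- The part of the sector with chord at distance `h` from the apex that lies below the parabola
through the endpoints of the chord with vertex at distance `δ` on the axis. With `δ = h` the
parabola is the chord. The inequality is multiplied by the squared half-chord `R² - h²`, and
`‖v‖² - ⟪e, v⟫²` is the squared distance of `v` from the axis. -/
def truncatedSector (R h δ : ℝ) (e : ℂ) : Set ℂ :=
  {v | v ∈ sector R (h / R) e ∧
    (R ^ 2 - h ^ 2) * inner ℝ e v < (R ^ 2 - h ^ 2) * δ - (δ - h) * (‖v‖ ^ 2 - inner ℝ e v ^ 2)}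

theorem measurable_inner_left (e : ℂ) : Measurable fun v : ℂ => inner ℝ e v :=
  (continuous_const.inner continuous_id).measurable

theorem measurableSet_sector (R c : ℝ) (e : ℂ) : MeasurableSet (sector R c e) :=
  (measurableSet_lt measurable_norm measurable_const).inter
    (measurableSet_lt (measurable_norm.const_mul c) (measurable_inner_left e))

theorem measurableSet_truncatedSector (R h δ : ℝ) (e : ℂ) :
    MeasurableSet (truncatedSector R h δ e) := by
  have := measurable_inner_left e
  refine (measurableSet_sector R (h / R) e).inter (measurableSet_lt
    (f := fun v : ℂ => (R ^ 2 - h ^ 2) * inner ℝ e v)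
    (g := fun v : ℂ => (R ^ 2 - h ^ 2) * δ - (δ - h) * (‖v‖ ^ 2 - inner ℝ e v ^ 2)) ?_ ?_)
  · fun_prop
  · fun_prop

/-- A truncated sector fills at least a fraction `κ` of its sector as soon as this holds for the
two explicit areas. -/
theorem volume_sector_le_truncatedSector {R h δ κ : ℝ} {e : ℂ} (he : ‖e‖ = 1) (hh : 0 < h)
    (hhR : h < R) (hδ : h ≤ δ) (hδR : δ < R) (hκ : 0 ≤ κ)
    (hangle : κ * (R ^ 2 * Real.arccos (h / R)) ≤ √(R ^ 2 - h ^ 2) * (4 * δ - h) / 3) :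
    ENNReal.ofReal κ * volume (sector R (h / R) e) ≤ volume (truncatedSector R h δ e) := by
  have hR : 0 < R := hh.trans hhR
  have hw2 : 0 < R ^ 2 - h ^ 2 := by nlinarith
  set w := √(R ^ 2 - h ^ 2) with hw
  have hwpos : 0 < w := Real.sqrt_pos.mpr hw2
  have hwsq : w ^ 2 = R ^ 2 - h ^ 2 := Real.sq_sqrt hw2.le
  -- The rotation taking `e` to `1`.
  let u : Circle := ⟨starRingEnd ℂ e, by
    rw [Submonoid.unitSphere, ]; simp [he]⟩
  let T : ℂ ≃ₗᵢ[ℝ] ℂ := rotation u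
  have hTre : ∀ v, (T v).re = inner ℝ e v := fun v => by
    rw [Complex.inner, mul_comm]
    rfl
  have hTnorm : ∀ v, ‖T v‖ = ‖v‖ := T.norm_map
  have hTim : ∀ v, (T v).im ^ 2 = ‖v‖ ^ 2 - inner ℝ e v ^ 2 := fun v => by
    rw [← hTnorm, ← hTre, Complex.sq_norm, Complex.normSq_apply]; ring
  have hT : MeasurePreserving T volume volume := T.measurePreserving
  have h1 : volume (sector R (h / R) e) ≤ ENNReal.ofReal (Real.arccos (h / R) * R ^ 2) := by
    refine le_trans (le_of_eq ?_) (volume_sector_le (h / R) hR)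
    rw [← hT.measure_preimage_equiv (f := T.toHomeomorph.toMeasurableEquiv)
      {v : ℂ | ‖v‖ < R ∧ h / R * ‖v‖ < v.re}]
    congr 1
    ext v
    change ‖v‖ < R ∧ h / R * ‖v‖ < inner ℝ e v ↔
      ‖T v‖ < R ∧ h / R * ‖T v‖ < (T v).re
    rw [hTnorm, hTre]
  have h2 : ENNReal.ofReal (w * (4 * δ - h) / 3) ≤ volume (truncatedSector R h δ e) := by
    rw [← volume_parabolic_cap hwpos hh.le hδ,
      ← hT.measure_preimage_equiv (f := T.toHomeomorph.toMeasurableEquiv)]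
    apply measure_mono
    intro v hv
    obtain ⟨hv1, hv2, hv3⟩ :
      |(T v).im| < w ∧ |(T v).im| * (h / w) < (T v).re ∧
        (T v).re < δ - (δ - h) * ((T v).im / w) ^ 2 := hv
    have hsq := hTim v
    have hz2 : (T v).im ^ 2 < w ^ 2 := sq_lt_sq' (abs_lt.mp hv1).1 (abs_lt.mp hv1).2
    rw [hTre] at hv2 hv3
    set y := inner ℝ e v
    have hy : 0 < y := lt_of_le_of_lt (by positivity) hv2
    have hv2' : |(T v).im| * h < y * w := by
      rwa [← mul_div_assoc, div_lt_iff₀ hwpos] at hv2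
    have hv3' : w ^ 2 * y < w ^ 2 * δ - (δ - h) * (T v).im ^ 2 := by
      have := mul_lt_mul_of_pos_left hv3 (by positivity : 0 < w ^ 2)
      have e1 : w ^ 2 * (δ - (δ - h) * ((T v).im / w) ^ 2) =
          w ^ 2 * δ - (δ - h) * (T v).im ^ 2 := by field_simp
      rwa [e1] at this
    refine ⟨⟨?_, ?_⟩, ?_⟩
    · have e2 : ((T v).im / w) ^ 2 < 1 := by
        rw [div_pow, div_lt_one (by positivity)]; exact hz2
      have e3 : (T v).im ^ 2 = ((T v).im / w) ^ 2 * w ^ 2 := by field_simp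
      have e4 : 0 ≤ ((T v).im / w) ^ 2 := by positivity
      set s := ((T v).im / w) ^ 2
      have e5 : y ^ 2 < (1 - s) * δ ^ 2 + s * h ^ 2 := by
        have : y ^ 2 < (δ - (δ - h) * s) ^ 2 := by gcongr
        nlinarith [mul_nonneg (mul_nonneg e4 (sub_nonneg.mpr e2.le)) (sq_nonneg (δ - h))]
      have e6 : δ ^ 2 < R ^ 2 := by nlinarith
      have e7 : ‖v‖ ^ 2 < R ^ 2 := by nlinarith
      exact lt_of_pow_lt_pow_left₀ 2 hR.le e7
    · rw [div_mul_eq_mul_div, div_lt_iff₀ hR]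
      apply lt_of_pow_lt_pow_left₀ 2 (by positivity)
      have : (|(T v).im| * h) ^ 2 < (y * w) ^ 2 := by gcongr
      rw [mul_pow, sq_abs] at this
      nlinarith
    · rw [← hwsq, ← hsq]
      exact hv3'
  calc _ ≤ ENNReal.ofReal κ * ENNReal.ofReal (Real.arccos (h / R) * R ^ 2) := by gcongr
    _ = ENNReal.ofReal (κ * (R ^ 2 * Real.arccos (h / R))) := by
        rw [← ENNReal.ofReal_mul hκ]; congr 1; ring
    _ ≤ _ := (ENNReal.ofReal_le_ofReal hangle).trans h2

/-- If `C` contains `B` outside disjoint sets `A j`, and also a subset `G j` of each `A j` of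
relative measure at least `κ ≤ 1`, then `C` has at least `κ` times the measure of `B`. -/
theorem mul_measure_le_of_disjoint_parts {α ι : Type*} [MeasurableSpace α] (μ : Measure α)
    {B C : Set α} (J : Finset ι) (A G : ι → Set α) {κ : ℝ≥0∞} (hκ : κ ≤ 1)
    (hA : ∀ j ∈ J, MeasurableSet (A j)) (hG : ∀ j ∈ J, MeasurableSet (G j))
    (hGA : ∀ j ∈ J, G j ⊆ A j)
    (hdisj : (J : Set ι).PairwiseDisjoint A) (hle : ∀ j ∈ J, κ * μ (A j) ≤ μ (G j))
    (hrest : B \ ⋃ j ∈ J, A j ⊆ C) (hGC : ∀ j ∈ J, G j ⊆ C) : κ * μ B ≤ μ C := by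
  set U := ⋃ j ∈ J, A j with hU
  have hUm : MeasurableSet U := J.measurableSet_biUnion hA
  have hGU : ⋃ j ∈ J, G j ⊆ U := iUnion₂_mono hGA
  calc κ * μ B ≤ κ * (μ U + μ (B \ U)) := by
        gcongr
        rw [← measure_inter_add_sdiff B hUm]
        gcongr
        exact inter_subset_right
    _ ≤ ∑ j ∈ J, κ * μ (A j) + 1 * μ (B \ U) := by
        rw [mul_add, hU, measure_biUnion_finset hdisj hA, Finset.mul_sum]
        gcongr
    _ ≤ ∑ j ∈ J, μ (G j) + μ (B \ U) := by
        rw [one_mul]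
        gcongr with j hj
        exact hle j hj
    _ = μ ((⋃ j ∈ J, G j) ∪ B \ U) := by
        rw [measure_union' _ (J.measurableSet_biUnion hG), measure_biUnion_finset _ hG]
        · exact hdisj.mono_on hGA
        · exact disjoint_sdiff_right.mono_left hGU
    _ ≤ μ C := measure_mono (union_subset (iUnion₂_subset hGC) hrest)

/-! ### The hexagonal fraction and the angle inequalities -/

/-- The fraction `√12 / (π R²)`, where `R² = 4 / 3`, that a regular hexagon of inradius `1` fills of
its circumscribed disc. -/
noncomputable def hexagonDensity : ℝ := 3 * √3 / (2 * Real.pi)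

theorem hexagonDensity_nonneg : 0 ≤ hexagonDensity := by
  unfold hexagonDensity; positivity

theorem sqrt_three_lt : √3 < 1.7321 := by
  rw [Real.sqrt_lt' (by norm_num)]; norm_num

theorem hexagonDensity_le_one : hexagonDensity ≤ 1 := by
  unfold hexagonDensity
  rw [div_le_one (by positivity)]
  linarith [sqrt_three_lt, Real.pi_gt_d2]

/-- For half-angles `α ≤ π / 6`, a triangle fills at least the hexagonal fraction of its sector:
`sin (2α) / (2α)` decreases in `α`, with the hexagonal value at `π / 6`. -/
theorem hexagonDensity_mul_arccos_le {c : ℝ} (hc : √3 / 2 ≤ c) (hc1 : c < 1) :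
    hexagonDensity * Real.arccos c ≤ c * √(1 - c ^ 2) := by
  set α := Real.arccos c with hα
  have h0 : 0 < α := Real.arccos_pos.mpr hc1
  have h3 : (0:ℝ) < √3 := by positivity
  have h6 : α ≤ Real.pi / 6 := by
    have := Real.arccos_le_arccos hc
    rwa [← Real.cos_pi_div_six, Real.arccos_cos (by positivity)
      (by linarith [Real.pi_pos])] at this
  have hcos : Real.cos α = c := Real.cos_arccos (by linarith) hc1.le
  have hsin : Real.sin α = √(1 - c ^ 2) := Real.sin_arccos c
  have hconc := strictConcaveOn_sin_Icc.concaveOn.2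
    (show (0 : ℝ) ∈ Icc 0 Real.pi from ⟨le_rfl, Real.pi_pos.le⟩)
    (show Real.pi / 3 ∈ Icc 0 Real.pi from ⟨by positivity, by linarith [Real.pi_pos]⟩)
    (show 0 ≤ 1 - 6 * α / Real.pi by rw [sub_nonneg, div_le_one Real.pi_pos]; linarith)
    (show 0 ≤ 6 * α / Real.pi by positivity) (by ring)
  simp only [smul_eq_mul, Real.sin_zero, mul_zero, zero_add, Real.sin_pi_div_three] at hconc
  have e : 6 * α / Real.pi * (Real.pi / 3) = 2 * α := by
    field_simp; ring
  rw [e, Real.sin_two_mul] at hconc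
  rw [← hsin, ← hcos]
  unfold hexagonDensity
  have : 6 * α / Real.pi * (√3 / 2) = 2 * (3 * √3 / (2 * Real.pi) * α) := by field_simp; ring
  linarith

/-- The bound `x ≤ tan x` for the excess `x` of an angle over `π / 6`, made explicit. Here `v / 2`
is the sine of the angle whose cosine is `(1 - k) √3 / 2`. -/
theorem arccos_le_of_le_cos_pi_div_six {k v : ℝ} (hk0 : 0 ≤ k) (hk : k ≤ 1 / 8)
    (hv : 0 ≤ v) (hv2 : v ^ 2 = 1 + 6 * k - 3 * k ^ 2) :
    (Real.arccos ((1 - k) * (√3 / 2)) - Real.pi / 6) * (3 * (1 - k) + v) ≤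
      √3 * (v - (1 - k)) := by
  have h3 : √3 ^ 2 = 3 := Real.sq_sqrt (by norm_num)
  have h3p : (0:ℝ) < √3 := by positivity
  set c := (1 - k) * (√3 / 2) with hc
  have hc0 : 0 ≤ c := mul_nonneg (by linarith) (by positivity)
  have hc6 : c ≤ √3 / 2 := by nlinarith
  have hc1 : c ≤ 1 := by linarith [sqrt_three_lt]
  have hlow : Real.pi / 6 ≤ Real.arccos c := by
    have := Real.arccos_le_arccos hc6
    rwa [← Real.cos_pi_div_six, Real.arccos_cos (by positivity)
      (by linarith [Real.pi_pos])] at this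
  have hup : Real.arccos c ≤ Real.pi / 2 := Real.arccos_le_pi_div_two.mpr hc0
  have hs : √(1 - c ^ 2) = v / 2 := by
    have : 1 - c ^ 2 = (v / 2) ^ 2 := by
      rw [hc, div_pow, hv2, mul_pow, div_pow, h3]; ring
    rw [this, Real.sqrt_sq (by linarith)]
  have htan := Real.le_tan (x := Real.arccos c - Real.pi / 6) (by linarith)
    (by linarith [Real.pi_pos])
  have hcos : 0 < Real.cos (Real.arccos c - Real.pi / 6) :=
    Real.cos_pos_of_mem_Ioo ⟨by linarith [Real.pi_pos], by linarith [Real.pi_pos]⟩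
  rw [Real.tan_eq_sin_div_cos, le_div_iff₀ hcos, Real.sin_sub, Real.cos_sub,
    Real.cos_arccos (by linarith) hc1, Real.sin_arccos, hs, Real.cos_pi_div_six,
    Real.sin_pi_div_six] at htan
  have e : c * (√3 / 2) = 3 / 4 * (1 - k) := by
    rw [hc]; linear_combination (1 - k) / 4 * h3
  rw [e] at htan
  linarith

/-- Angle inequality for a sector truncated by the parabola with `h = 1 - k` and
`δ = 1 + 0.16 k`. The half-angle may exceed `π / 6`, and the rise of the parabola over its chord
makes up for it. The inequality is an equality at `k = 0`. -/
theorem hexagonDensity_mul_arccos_le_of_curved {k : ℝ} (hk0 : 0 ≤ k) (hk : k ≤ 1 / 8) :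
    hexagonDensity * (4 / 3 * Real.arccos ((1 - k) * (√3 / 2))) ≤
      √(4 / 3 - (1 - k) ^ 2) * (4 * (1 + 16 / 100 * k) - (1 - k)) / 3 := by
  have h3 : √3 ^ 2 = 3 := Real.sq_sqrt (by norm_num)
  have h3p : (0:ℝ) < √3 := by positivity
  have hπ := Real.pi_pos
  set v := √3 * √(4 / 3 - (1 - k) ^ 2) with hv
  have hv0 : 0 ≤ v := by positivity
  have hv2 : v ^ 2 = 1 + 6 * k - 3 * k ^ 2 := by
    rw [hv, mul_pow, h3, Real.sq_sqrt (by nlinarith)]; ring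
  have hx := arccos_le_of_le_cos_pi_div_six hk0 hk hv0 hv2
  have hw : √(4 / 3 - (1 - k) ^ 2) = v * √3 / 3 := by rw [hv]; nlinarith
  rw [hw]
  set x := Real.arccos ((1 - k) * (√3 / 2)) - Real.pi / 6 with hxdef
  have hβ : Real.arccos ((1 - k) * (√3 / 2)) = Real.pi / 6 + x := by rw [hxdef]; ring
  rw [hβ]
  have hlhs : hexagonDensity * (4 / 3 * (Real.pi / 6 + x)) =
      √3 / 3 * (1 + 6 / Real.pi * x) := by
    unfold hexagonDensity; field_simp; ring
  rw [hlhs]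
  have hv1 : 1 ≤ v := by nlinarith
  have hvk : v ≤ 1 + 3 * k := by nlinarith
  have hden : 0 < 3 * (1 - k) + v := by linarith
  have hpoly : 3.31 * (v - (1 - k)) ≤ (v * (1 + 41 / 75 * k) - 1) * (3 * (1 - k) + v) := by
    have : (v * (1 + 41 / 75 * k) - 1) * (3 * (1 - k) + v) - 3.31 * (v - (1 - k)) =
      1.31 * (1 - v) + 5.69 * k - 3 * k ^ 2 - 3 * k * v +
        41 / 75 * k * (3 * v - 3 * k * v + (1 + 6 * k - 3 * k ^ 2)) := by
      rw [← hv2]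
      linear_combination hv2
    have h1 : k * v ≤ k * (1 + 3 * k) := by gcongr
    have h2 : k ^ 2 * v ≤ k ^ 2 * (1 + 3 * k) := by gcongr
    nlinarith [mul_nonneg hk0 (sub_nonneg.mpr hk),
      mul_nonneg (mul_nonneg hk0 hk0) (sub_nonneg.mpr hk)]
  have hx2 : 6 / Real.pi * x * (3 * (1 - k) + v) ≤ 3.31 * (v - (1 - k)) := by
    -- The true value is about `3.308`.
    have h4 : 6 / Real.pi * √3 ≤ 3.31 := by
      rw [div_mul_eq_mul_div, div_le_iff₀ hπ]
      linarith [sqrt_three_lt, Real.pi_gt_d2]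
    calc _ = 6 / Real.pi * (x * (3 * (1 - k) + v)) := by ring
      _ ≤ 6 / Real.pi * (√3 * (v - (1 - k))) := by gcongr
      _ = 6 / Real.pi * √3 * (v - (1 - k)) := by ring
      _ ≤ _ := by
        apply mul_le_mul_of_nonneg_right h4
        linarith
  have hfin : 6 / Real.pi * x ≤ v * (1 + 41 / 75 * k) - 1 :=
    le_of_mul_le_mul_right (hx2.trans hpoly) hden
  calc _ ≤ √3 / 3 * (1 + (v * (1 + 41 / 75 * k) - 1)) := by gcongr
    _ = _ := by ring


/-! ### Voronoi cells clipped at the circumradius -/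

/-- The circumradius of an equilateral triangle of side `2`, at which Voronoi cells are clipped. -/
noncomputable def circumradius : ℝ := 2 / √3

theorem circumradius_pos : 0 < circumradius := by unfold circumradius; positivity

theorem circumradius_sq : circumradius ^ 2 = 4 / 3 := by
  unfold circumradius
  rw [div_pow, Real.sq_sqrt (by norm_num)]; norm_num

theorem circumradius_lt : circumradius < 1.16 := by
  have := circumradius_sq
  have := circumradius_pos
  nlinarith

theorem one_lt_circumradius : 1 < circumradius := by
  have := circumradius_sq
  have := circumradius_pos
  nlinarith

theorem div_circumradius (h : ℝ) : h / circumradius = h * (√3 / 2) := by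
  unfold circumradius; field_simp

theorem hexagonDensity_mul_volume_ball (x : ℂ) :
    ENNReal.ofReal hexagonDensity * volume (Metric.ball x circumradius) =
      ENNReal.ofReal (2 * √3) := by
  rw [Complex.volume_ball, ← ENNReal.ofReal_pow circumradius_pos.le, circumradius_sq,
    show (NNReal.pi : ℝ≥0∞) = ENNReal.ofReal Real.pi from by
      rw [← NNReal.coe_real_pi, ENNReal.ofReal_coe_nnreal],
    ← ENNReal.ofReal_mul (by norm_num), ← ENNReal.ofReal_mul hexagonDensity_nonneg]
  congr 1
  unfold hexagonDensity
  have := Real.pi_pos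
  field_simp
  ring

/-- The sector over the cap that the perpendicular bisector of `0` and `z` cuts off from the disc
of radius `circumradius`. It is empty if the bisector misses the disc. -/
def bisectorSector (z : ℂ) : Set ℂ :=
  sector circumradius (‖z‖ / 2 / circumradius) (‖z‖⁻¹ • z)

/-- The part of `bisectorSector z` on the near side of the bisector of `0` and `z`. -/
def bisectorTriangle (z : ℂ) : Set ℂ :=
  truncatedSector circumradius (‖z‖ / 2) (‖z‖ / 2) (‖z‖⁻¹ • z)

theorem norm_inv_norm_smul {z : ℂ} (hz : 0 < ‖z‖) : ‖(‖z‖⁻¹ • z : ℂ)‖ = 1 := by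
  rw [norm_smul, norm_inv, norm_norm, inv_mul_cancel₀ hz.ne']

theorem sector_eq_empty {R h : ℝ} {e : ℂ} (he : ‖e‖ = 1) (hR : 0 < R) (hh : R ≤ h) :
    sector R (h / R) e = ∅ := by
  rw [eq_empty_iff_forall_notMem]
  rintro v ⟨-, hv⟩
  have h1 := real_inner_le_norm e v
  have h2 : 1 ≤ h / R := (one_le_div hR).mpr hh
  rw [he, one_mul] at h1
  nlinarith [norm_nonneg v]

theorem volume_bisectorSector_le {z : ℂ} (hz : 2 ≤ ‖z‖) :
    ENNReal.ofReal hexagonDensity * volume (bisectorSector z) ≤ volume (bisectorTriangle z) := by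
  have he := norm_inv_norm_smul (show 0 < ‖z‖ by linarith)
  have hR := circumradius_pos
  have hR2 := circumradius_sq
  rcases lt_or_ge (‖z‖ / 2) circumradius with h | h
  · refine volume_sector_le_truncatedSector he (by linarith) h le_rfl h hexagonDensity_nonneg ?_
    set c := ‖z‖ / 2 / circumradius with hc
    have hz2 : ‖z‖ / 2 = c * circumradius := by rw [hc]; field_simp
    have h1 : √3 / 2 ≤ c := by
      rw [hc, div_circumradius]
      exact le_mul_of_one_le_left (by positivity) (by linarith)
    have h2 : c < 1 := (div_lt_one hR).mpr h
    have h3 := hexagonDensity_mul_arccos_le h1 h2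
    have h4 : √(circumradius ^ 2 - (‖z‖ / 2) ^ 2) = circumradius * √(1 - c ^ 2) := by
      rw [hz2, ← Real.sqrt_sq hR.le, ← Real.sqrt_mul (by positivity), Real.sqrt_sq hR.le]
      congr 1; ring
    rw [h4, hz2]
    nlinarith [mul_le_mul_of_nonneg_left h3 (sq_nonneg circumradius)]
  · rw [bisectorSector, sector_eq_empty he hR h]
    simp

theorem norm_lt_norm_sub_iff (v z : ℂ) : ‖v‖ < ‖v - z‖ ↔ 2 * inner ℝ z v < ‖z‖ ^ 2 := by
  have h := norm_sub_sq_real v z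
  rw [real_inner_comm] at h
  rw [← pow_lt_pow_iff_left₀ (norm_nonneg _) (norm_nonneg _) two_ne_zero, h]
  constructor <;> intro <;> linarith

/-- Membership in a sector is inherited by the radial projection to the bounding circle. -/
theorem exists_radial_projection {v : ℂ} {R c : ℝ} {e : ℂ} (hR : 0 < R)
    (hv : v ∈ sector R c e) : 0 < ‖v‖ ∧ ‖(R / ‖v‖) • v‖ = R ∧
      c * R < inner ℝ e ((R / ‖v‖) • v) := by
  obtain ⟨-, h⟩ := hv
  have hv0 : 0 < ‖v‖ := by
    rw [norm_pos_iff]; rintro rfl; simp at h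
  refine ⟨hv0, ?_, ?_⟩
  · rw [norm_smul, norm_div, norm_norm, Real.norm_of_nonneg hR.le, div_mul_cancel₀ _ hv0.ne']
  · rw [inner_smul_right]
    calc c * R = R / ‖v‖ * (c * ‖v‖) := by field_simp
      _ < _ := by gcongr

theorem radial_projection_of_mem_bisectorSector {v z : ℂ} (hz : 2 ≤ ‖z‖)
    (hv : v ∈ bisectorSector z) :
    ‖z‖ ^ 2 / 2 < inner ℝ z ((circumradius / ‖v‖) • v) := by
  obtain ⟨-, -, h⟩ := exists_radial_projection circumradius_pos hv
  have hR := circumradius_pos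
  rw [inner_smul_left, div_mul_cancel₀ _ hR.ne', conj_trivial, inv_mul_eq_div,
    lt_div_iff₀ (by linarith)] at h
  linarith

/-- A common direction would give a point of the circle about `0` of radius `circumradius` that is
strictly closer to both `z` and `z'` than to `0`. -/
theorem disjoint_bisectorSector {z z' : ℂ} (hz : 2 ≤ ‖z‖) (hz' : 2 ≤ ‖z'‖)
    (h : 2 ≤ ‖z - z'‖) : Disjoint (bisectorSector z) (bisectorSector z') := by
  rw [Set.disjoint_left]
  intro v hv hv'
  have h1 := radial_projection_of_mem_bisectorSector hz hv
  have h2 := radial_projection_of_mem_bisectorSector hz' hv'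
  obtain ⟨-, hp, -⟩ := exists_radial_projection circumradius_pos hv
  set p := (circumradius / ‖v‖) • v
  have hp2 : ‖p‖ ^ 2 = 4 / 3 := by rw [hp, circumradius_sq]
  have hd : ∀ y : ℂ, ‖y‖ ^ 2 / 2 < inner ℝ y p → ‖p - y‖ ^ 2 < 4 / 3 := fun y hy => by
    rw [norm_sub_sq_real, real_inner_comm, hp2]; linarith
  refine no_three_within_circumradius (a := p) (b := p - z) (c := p - z') hp2.le (hd z h1)
    (hd z' h2) ?_ ?_ ?_
  · simpa using hz
  · simpa using hz'
  · rw [sub_sub_sub_cancel_left, norm_sub_rev]; exact h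

theorem norm_lt_of_notMem_bisectorSector {v z : ℂ} (hz : 2 ≤ ‖z‖) (hv : ‖v‖ < circumradius)
    (h : v ∉ bisectorSector z) : ‖v‖ < ‖v - z‖ := by
  rw [norm_lt_norm_sub_iff]
  have hR := circumradius_pos
  have h1 : inner ℝ (‖z‖⁻¹ • z) v ≤ ‖z‖ / 2 / circumradius * ‖v‖ := by
    by_contra! h2
    exact h ⟨hv, h2⟩
  have h2 : ‖z‖ / 2 / circumradius * ‖v‖ < ‖z‖ / 2 := by
    rw [div_mul_eq_mul_div, div_lt_iff₀ hR]
    gcongr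
  rw [inner_smul_left, conj_trivial, inv_mul_eq_div] at h1
  have h3 := (div_lt_iff₀ (by linarith)).mp (h1.trans_lt h2)
  linarith

theorem norm_lt_of_mem_bisectorTriangle {v z : ℂ} (hz : 2 ≤ ‖z‖) (hv : v ∈ bisectorTriangle z) :
    ‖v‖ < ‖v - z‖ := by
  have he := norm_inv_norm_smul (show 0 < ‖z‖ by linarith)
  obtain ⟨h1, h2⟩ := hv
  have hlt : ‖z‖ / 2 < circumradius := by
    by_contra! hge
    rw [sector_eq_empty he circumradius_pos hge] at h1
    exact h1
  rw [sub_self, zero_mul, sub_zero] at h2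
  have h3 := lt_of_mul_lt_mul_left h2 (by nlinarith)
  rw [inner_smul_left, conj_trivial, inv_mul_eq_div, div_lt_iff₀ (by linarith)] at h3
  rw [norm_lt_norm_sub_iff]
  linarith

/-- The Voronoi cell of `0` in a separated configuration, clipped by the disc of radius
`circumradius` and possibly once more inside a further sector `A₀` (down to `G₀`), still has at
least the area `2√3` of the hexagon. -/
theorem volume_cell_ge {Z : Finset ℂ} (hZ : ∀ z ∈ Z, 2 ≤ ‖z‖)
    (hsep : ∀ z ∈ Z, ∀ z' ∈ Z, z ≠ z' → 2 ≤ ‖z - z'‖) {A₀ G₀ : Set ℂ}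
    (hA₀ : MeasurableSet A₀) (hG₀ : MeasurableSet G₀) (hGA : G₀ ⊆ A₀)
    (hAR : ∀ v ∈ A₀, ‖v‖ < circumradius)
    (hdisj : ∀ z ∈ Z, Disjoint A₀ (bisectorSector z))
    (hle : ENNReal.ofReal hexagonDensity * volume A₀ ≤ volume G₀) :
    ENNReal.ofReal (2 * √3) ≤
      volume {v : ℂ | ‖v‖ < circumradius ∧ (∀ z ∈ Z, ‖v‖ < ‖v - z‖) ∧ (v ∈ A₀ → v ∈ G₀)} := by
  rw [← hexagonDensity_mul_volume_ball 0]
  let A : Option ℂ → Set ℂ := fun o => o.elim A₀ bisectorSector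
  let G : Option ℂ → Set ℂ := fun o => o.elim G₀ bisectorTriangle
  have hGAz : ∀ z, bisectorTriangle z ⊆ bisectorSector z := fun z v hv => hv.1
  refine mul_measure_le_of_disjoint_parts volume (Finset.insertNone Z) A G
    (ENNReal.ofReal_le_one.mpr hexagonDensity_le_one) ?_ ?_ ?_ ?_ ?_ ?_ ?_
  · rintro (_ | z) -
    exacts [hA₀, measurableSet_sector _ _ _]
  · rintro (_ | z) -
    exacts [hG₀, measurableSet_truncatedSector _ _ _ _]
  · rintro (_ | z) -
    exacts [hGA, hGAz z]
  · rintro (_ | z) hz (_ | z') hz' hne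
    · exact absurd rfl hne
    · exact hdisj z' (by simpa using hz')
    · exact (hdisj z (by simpa using hz)).symm
    · have h1 : z ∈ Z := by simpa using hz
      have h2 : z' ∈ Z := by simpa using hz'
      exact disjoint_bisectorSector (hZ z h1) (hZ z' h2)
        (hsep z h1 z' h2 fun h => hne (congrArg some h))
  · rintro (_ | z) hz
    · exact hle
    · exact volume_bisectorSector_le (hZ z (by simpa using hz))
  · rintro v ⟨hv, hvA⟩
    rw [mem_ball_zero_iff] at hv
    have h0 : ∀ o ∈ Finset.insertNone Z, v ∉ A o := fun o ho hvo => hvA (mem_biUnion ho hvo)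
    refine ⟨hv, fun z hz => ?_, fun h => absurd h (h0 none (by simp))⟩
    exact norm_lt_of_notMem_bisectorSector (hZ z hz) hv (h0 (some z) (by simpa using hz))
  · rintro (_ | z) hz v hv
    · refine ⟨hAR v (hGA hv), fun z hz => ?_, fun _ => hv⟩
      exact norm_lt_of_notMem_bisectorSector (hZ z hz) (hAR v (hGA hv))
        (Set.disjoint_left.mp (hdisj z hz) (hGA hv))
    · have hzZ : z ∈ Z := by simpa using hz
      have hvA := hGAz z hv
      refine ⟨hvA.1, fun z' hz' => ?_, fun h => ?_⟩
      · by_cases hzz : z = z'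
        · subst hzz; exact norm_lt_of_mem_bisectorTriangle (hZ z hzZ) hv
        · exact norm_lt_of_notMem_bisectorSector (hZ z' hz') hvA.1
            (Set.disjoint_left.mp (disjoint_bisectorSector (hZ z hzZ) (hZ z' hz')
              (hsep z hzZ z' hz' hzz)) hvA)
      · exact absurd hvA (Set.disjoint_left.mp (hdisj z hzZ) h)

/-! ### Cells near the boundary of the disc -/

/-- If `p` has norm `2 / √3`, is closer to `z` than to `0`, and makes an angle with the unit vector
`e` of cosine at least `7√3 / 16`, then `z` points to the side of `e`. -/
theorem inner_ge_of_bisector {e p z : ℂ} (he : ‖e‖ = 1) (hp : ‖p‖ ^ 2 = 4 / 3)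
    (hep : 7 / 8 ≤ inner ℝ e p) (hz : 2 ≤ ‖z‖) (hzp : ‖z‖ ^ 2 / 2 < inner ℝ z p) :
    1 / 4 ≤ inner ℝ e z := by
  set E := inner ℝ e p with hE
  set ζ := inner ℝ z p with hζ
  -- Cauchy–Schwarz for the components of `e` and `z` orthogonal to `p`.
  have hcs := real_inner_mul_inner_self_le ((4 / 3 : ℝ) • e - E • p) ((4 / 3 : ℝ) • z - ζ • p)
  simp only [inner_sub_left, inner_sub_right, inner_smul_left, inner_smul_right, conj_trivial,
    real_inner_self_eq_norm_sq, he, hp, real_inner_comm e p, ← hE, real_inner_comm z p,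
    ← hζ] at hcs
  have hE2 : E ^ 2 ≤ 4 / 3 := by
    have := real_inner_mul_inner_self_le e p
    rw [real_inner_self_eq_norm_sq, real_inner_self_eq_norm_sq, he, hp, ← hE] at this
    linarith
  by_contra! hg
  have hζ2 : 2 < ζ := by nlinarith
  have h1 : 1.4 < E * ζ - 4 / 3 * inner ℝ e z := by nlinarith
  have h2 : 4 / 3 * ‖z‖ ^ 2 - ζ ^ 2 ≤ 4 / 3 := by nlinarith
  have h3 : (4 / 3 - E ^ 2) * (4 / 3 * ‖z‖ ^ 2 - ζ ^ 2) ≤ (4 / 3 - E ^ 2) * (4 / 3) :=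
    mul_le_mul_of_nonneg_left h2 (by linarith)
  nlinarith


/-- For a centre `x` near the boundary of the disc of radius `r`, a neighbour `x + z` in that disc
cuts off no direction in the boundary sector: otherwise `x + z` would lie outside the disc. -/
theorem disjoint_boundarySector {x z : ℂ} {r h : ℝ} (hh : 7 / 8 ≤ h)
    (hx : r + 1 - circumradius < ‖x‖) (hr : 1 ≤ r) (hz : 2 ≤ ‖z‖) (hxz : ‖x + z‖ ≤ r) :
    Disjoint (sector circumradius (h / circumradius) (‖x‖⁻¹ • x)) (bisectorSector z) := by
  rw [Set.disjoint_left]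
  intro v hv hvz
  have hR := circumradius_pos
  have hR1 := circumradius_lt
  have hx0 : 0 < ‖x‖ := by linarith
  have h1 := radial_projection_of_mem_bisectorSector hz hvz
  obtain ⟨-, hp, h2⟩ := exists_radial_projection hR hv
  rw [div_mul_cancel₀ _ hR.ne'] at h2
  have hp2 : ‖(circumradius / ‖v‖) • v‖ ^ 2 = 4 / 3 := by rw [hp, circumradius_sq]
  have h3 := inner_ge_of_bisector (norm_inv_norm_smul hx0) hp2 (hh.trans h2.le) hz h1
  rw [inner_smul_left, conj_trivial, inv_mul_eq_div, le_div_iff₀ hx0] at h3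
  have h4 := norm_add_sq_real x z
  have h5 : ‖x + z‖ ^ 2 ≤ r ^ 2 := by gcongr
  nlinarith

/-- Outside the boundary sector, and below the parabola inside it, the disc of radius
`circumradius` about `x` stays in the disc of squared radius `(r + 1)² + 1/12`. -/
theorem norm_add_sq_le_of_boundary {x v : ℂ} {r h δ : ℝ} (hr : 0 ≤ r) (hx : 0 < ‖x‖)
    (hxr : ‖x‖ ≤ r) (hh : 0 < h) (hhR : h < circumradius)
    (hrh : 2 * r * h = 2 * r - 1 / 4) (hrδ : (r + δ) ^ 2 ≤ (r + 1) ^ 2 + 1 / 12)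
    (hv : ‖v‖ < circumradius)
    (hmem : v ∈ sector circumradius (h / circumradius) (‖x‖⁻¹ • x) →
      v ∈ truncatedSector circumradius h δ (‖x‖⁻¹ • x)) :
    ‖x + v‖ ^ 2 ≤ (r + 1) ^ 2 + 1 / 12 := by
  have hR := circumradius_pos
  have hR2 := circumradius_sq
  have hxv : inner ℝ x v = ‖x‖ * inner ℝ (‖x‖⁻¹ • x) v := by
    rw [inner_smul_left, conj_trivial, mul_inv_cancel_left₀ hx.ne']
  have hv2 : ‖v‖ ^ 2 < 4 / 3 := by rw [← hR2]; gcongr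
  rw [norm_add_sq_real, hxv]
  set y := inner ℝ (‖x‖⁻¹ • x) v with hy
  have hxr2 : ‖x‖ ^ 2 ≤ r ^ 2 := by gcongr
  by_cases hs : v ∈ sector circumradius (h / circumradius) (‖x‖⁻¹ • x)
  · obtain ⟨⟨-, h1⟩, h2⟩ := hmem hs
    rw [← hy] at h1 h2
    have hy0 : 0 < y := lt_of_le_of_lt (by positivity) h1
    rw [div_mul_eq_mul_div, div_lt_iff₀ hR] at h1
    have hw2 : 0 < circumradius ^ 2 - h ^ 2 :=
      sub_pos.mpr (pow_lt_pow_left₀ hhR hh.le two_ne_zero)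
    have hz : ‖v‖ ^ 2 - y ^ 2 < circumradius ^ 2 - h ^ 2 := by
      have h3 : (h * ‖v‖) ^ 2 < (y * circumradius) ^ 2 := by gcongr
      have h4 : (‖v‖ ^ 2 - y ^ 2) * (4 / 3) < (circumradius ^ 2 - h ^ 2) * ‖v‖ ^ 2 := by
        rw [mul_pow, mul_pow] at h3
        nlinarith
      have h5 : (circumradius ^ 2 - h ^ 2) * ‖v‖ ^ 2 ≤ (circumradius ^ 2 - h ^ 2) * (4 / 3) := by
        gcongr
      linarith
    have hz0 : 0 ≤ ‖v‖ ^ 2 - y ^ 2 := by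
      have := abs_real_inner_le_norm (‖x‖⁻¹ • x) v
      rw [norm_inv_norm_smul hx, one_mul, ← hy] at this
      have := pow_le_pow_left₀ (abs_nonneg y) this 2
      rw [sq_abs] at this
      linarith
    set W := circumradius ^ 2 - h ^ 2 with hW
    set u := (‖v‖ ^ 2 - y ^ 2) / W with hu
    have hzu : ‖v‖ ^ 2 - y ^ 2 = u * W := by rw [hu]; field_simp
    have hu0 : 0 ≤ u := by positivity
    have hu1 : u < 1 := (div_lt_one hw2).mpr hz
    rw [hzu] at h2
    have h6 : y < (1 - u) * δ + u * h := by
      have : W * y < W * ((1 - u) * δ + u * h) := by linarith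
      exact lt_of_mul_lt_mul_left this hw2.le
    -- Convexity of the square between the two ends of the parabolic arc.
    have h7 : (r + y) ^ 2 ≤ (1 - u) * (r + δ) ^ 2 + u * (r + h) ^ 2 := by
      have h8 : (r + y) ^ 2 ≤ (r + ((1 - u) * δ + u * h)) ^ 2 := by gcongr
      nlinarith [mul_nonneg (mul_nonneg hu0 (sub_nonneg.mpr hu1.le)) (sq_nonneg (δ - h))]
    have h9 : (r + h) ^ 2 + W = (r + 1) ^ 2 + 1 / 12 := by
      rw [hW, hR2]; linear_combination hrh
    have h10 : (1 - u) * (r + δ) ^ 2 ≤ (1 - u) * ((r + 1) ^ 2 + 1 / 12) :=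
      mul_le_mul_of_nonneg_left hrδ (by linarith)
    have h11 : ‖x‖ * y ≤ r * y := by gcongr
    have h12 : u * (r + h) ^ 2 + u * W = u * ((r + 1) ^ 2 + 1 / 12) := by
      rw [← mul_add, h9]
    have h13 : (r + y) ^ 2 = r ^ 2 + 2 * (r * y) + y ^ 2 := by ring
    linarith
  · have h1 : y ≤ h / circumradius * ‖v‖ := by
      by_contra! h2
      exact hs ⟨hv, h2⟩
    have h2 : y ≤ h := by
      refine h1.trans ?_
      rw [div_mul_eq_mul_div, div_le_iff₀ hR]
      gcongr
    have h3 : ‖x‖ * y ≤ r * h := calc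
      _ ≤ ‖x‖ * h := by gcongr
      _ ≤ _ := by gcongr
    nlinarith

theorem volume_boundarySector_le {k : ℝ} {e : ℂ} (he : ‖e‖ = 1) (hk0 : 0 ≤ k)
    (hk : k ≤ 1 / 8) :
    ENNReal.ofReal hexagonDensity *
      volume (sector circumradius ((1 - k) / circumradius) e) ≤
      volume (truncatedSector circumradius (1 - k) (1 + 16 / 100 * k) e) := by
  have hR := one_lt_circumradius
  have hR2 := circumradius_sq
  refine volume_sector_le_truncatedSector he (by linarith) (by linarith) (by linarith)
    (by nlinarith) hexagonDensity_nonneg ?_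
  rw [hR2, div_circumradius]
  exact hexagonDensity_mul_arccos_le_of_curved hk0 hk

/-! ### Packing in a disc -/

/-- The open Voronoi cell of `x` in `S`, clipped by the disc of radius `circumradius` about `x`
and by the disc of radius `ρ` about the origin. Strict inequalities make distinct cells
disjoint. -/
def clippedCell (S : Finset ℂ) (ρ : ℝ) (x : ℂ) : Set ℂ :=
  {y | ‖y - x‖ < circumradius ∧ (∀ x' ∈ S, x' ≠ x → ‖y - x‖ < ‖y - x'‖) ∧ ‖y‖ ≤ ρ}

theorem volume_clippedCell_ge {S : Finset ℂ} {r : ℝ} (hr : 1 ≤ r)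
    (hsep : ∀ x ∈ S, ∀ y ∈ S, x ≠ y → 2 ≤ ‖x - y‖) (hS : ∀ x ∈ S, ‖x‖ ≤ r) {x : ℂ}
    (hx : x ∈ S) :
    ENNReal.ofReal (2 * √3) ≤ volume (clippedCell S √((r + 1) ^ 2 + 1 / 12) x) := by
  have hR := circumradius_pos
  let Z : Finset ℂ := (S.erase x).image fun x' => x' - x
  have hZmem : ∀ z ∈ Z, ∃ x' ∈ S, x' ≠ x ∧ x' - x = z := fun z hz => by
    obtain ⟨x', hx', rfl⟩ := Finset.mem_image.mp hz
    exact ⟨x', Finset.mem_of_mem_erase hx', Finset.ne_of_mem_erase hx', rfl⟩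
  have hZ : ∀ z ∈ Z, 2 ≤ ‖z‖ := fun z hz => by
    obtain ⟨x', h1, h2, rfl⟩ := hZmem z hz
    exact hsep x' h1 x hx h2
  have hZsep : ∀ z ∈ Z, ∀ z' ∈ Z, z ≠ z' → 2 ≤ ‖z - z'‖ := fun z hz z' hz' hne => by
    obtain ⟨x', h1, -, rfl⟩ := hZmem z hz
    obtain ⟨x'', h2, -, rfl⟩ := hZmem z' hz'
    rw [sub_sub_sub_cancel_right]
    exact hsep x' h1 x'' h2 fun h => hne (by rw [h])
  -- It suffices to find a boundary sector together with a part of it that stays in the disc.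
  have key : ∀ A₀ G₀ : Set ℂ, MeasurableSet A₀ → MeasurableSet G₀ → G₀ ⊆ A₀ →
      (∀ v ∈ A₀, ‖v‖ < circumradius) → (∀ z ∈ Z, Disjoint A₀ (bisectorSector z)) →
      ENNReal.ofReal hexagonDensity * volume A₀ ≤ volume G₀ →
      (∀ v, ‖v‖ < circumradius → (v ∈ A₀ → v ∈ G₀) → ‖x + v‖ ^ 2 ≤ (r + 1) ^ 2 + 1 / 12) →
      ENNReal.ofReal (2 * √3) ≤ volume (clippedCell S √((r + 1) ^ 2 + 1 / 12) x) := by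
    intro A₀ G₀ hA hG hGA hAR hd hle hin
    refine (volume_cell_ge hZ hZsep hA hG hGA hAR hd hle).trans ?_
    rw [← measure_preimage_add volume x (clippedCell S _ x)]
    apply measure_mono
    rintro v ⟨h1, h2, h3⟩
    refine ⟨by simpa using h1, fun x' hx' hne => ?_, Real.le_sqrt_of_sq_le (hin v h1 h3)⟩
    have h4 := h2 (x' - x) (Finset.mem_image_of_mem _ (Finset.mem_erase.mpr ⟨hne, hx'⟩))
    rwa [add_sub_cancel_left, show x + v - x' = v - (x' - x) by ring]
  rcases le_or_gt ‖x‖ (r + 1 - circumradius) with hxr | hxr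
  · refine key ∅ ∅ .empty .empty subset_rfl (by simp) (by simp) (by simp) fun v hv _ => ?_
    have h1 : ‖x + v‖ ≤ r + 1 := (norm_add_le x v).trans (by linarith)
    have h2 : ‖x + v‖ ^ 2 ≤ (r + 1) ^ 2 := by gcongr
    linarith
  · have hx0 : 0 < ‖x‖ := by linarith [circumradius_lt]
    -- With this `k` the chord endpoints, at distance `circumradius` from a centre of norm `r`,
    -- lie on the large circle; the coefficient `0.16` keeps the vertex inside it.
    set k : ℝ := 1 / (8 * r) with hk
    have hr0 : 0 < r := by linarith
    have hkr : k * r = 1 / 8 := by rw [hk]; field_simp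
    have hk0 : 0 ≤ k := by positivity
    have hk8 : k ≤ 1 / 8 := by rw [← hkr]; nlinarith
    refine key (sector circumradius ((1 - k) / circumradius) (‖x‖⁻¹ • x))
      (truncatedSector circumradius (1 - k) (1 + 16 / 100 * k) (‖x‖⁻¹ • x))
      (measurableSet_sector _ _ _) (measurableSet_truncatedSector _ _ _ _)
      (fun v hv => hv.1) (fun v hv => hv.1) (fun z hz => ?_)
      (volume_boundarySector_le (norm_inv_norm_smul hx0) hk0 hk8) fun v hv hmem => ?_
    · obtain ⟨x', h1, -, h2⟩ := hZmem z hz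
      refine disjoint_boundarySector (by linarith) hxr hr (hZ z hz) ?_
      rw [← h2, add_sub_cancel]
      exact hS x' h1
    · refine norm_add_sq_le_of_boundary hr0.le hx0 (hS x hx) (by linarith)
        (by linarith [one_lt_circumradius]) (by linarith) ?_ hv hmem
      nlinarith

/-- Each clipped cell has area at least `2√3`, and the disjoint cells lie in a disc of squared
radius `(r + 1)² + 1/12`. -/
theorem card_mul_le_of_separated {S : Finset ℂ} {r : ℝ} (hr : 1 ≤ r)
    (hsep : ∀ x ∈ S, ∀ y ∈ S, x ≠ y → 2 ≤ ‖x - y‖) (hS : ∀ x ∈ S, ‖x‖ ≤ r) :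
    S.card * (2 * √3) ≤ Real.pi * ((r + 1) ^ 2 + 1 / 12) := by
  set ρ := √((r + 1) ^ 2 + 1 / 12) with hρ
  have hρ2 : ρ ^ 2 = (r + 1) ^ 2 + 1 / 12 := Real.sq_sqrt (by positivity)
  have hm : ∀ x ∈ S, MeasurableSet (clippedCell S ρ x) := fun x _ => by
    have h2 : {y : ℂ | ∀ x' ∈ S, x' ≠ x → ‖y - x‖ < ‖y - x'‖} =
        ⋂ x' ∈ S, {y : ℂ | x' ≠ x → ‖y - x‖ < ‖y - x'‖} := by
      ext y; simp
    refine (measurableSet_lt (measurable_id.sub_const x).norm measurable_const).inter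
      (MeasurableSet.inter ?_ (measurableSet_le measurable_norm measurable_const))
    change MeasurableSet {y : ℂ | ∀ x' ∈ S, x' ≠ x → ‖y - x‖ < ‖y - x'‖}
    rw [h2]
    refine S.measurableSet_biInter fun x' _ => ?_
    by_cases hne : x' = x
    · simp [hne]
    · simp only [hne, ne_eq, not_false_eq_true, forall_const]
      exact measurableSet_lt (by fun_prop) (by fun_prop)
  have hdisj : (S : Set ℂ).PairwiseDisjoint (clippedCell S ρ) := by
    intro x hx x' hx' hne
    refine Set.disjoint_left.mpr fun y h1 h2 => ?_
    exact lt_asymm (h1.2.1 x' hx' hne.symm) (h2.2.1 x hx hne)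
  have h1 : ENNReal.ofReal (S.card * (2 * √3)) ≤ ENNReal.ofReal (Real.pi * ρ ^ 2) := calc
    _ = ∑ x ∈ S, ENNReal.ofReal (2 * √3) := by
        rw [Finset.sum_const, ENNReal.ofReal_mul (by positivity), nsmul_eq_mul]
        simp
    _ ≤ ∑ x ∈ S, volume (clippedCell S ρ x) :=
        Finset.sum_le_sum fun x hx => volume_clippedCell_ge hr hsep hS hx
    _ = volume (⋃ x ∈ S, clippedCell S ρ x) := (measure_biUnion_finset hdisj hm).symm
    _ ≤ volume (Metric.closedBall (0 : ℂ) ρ) := by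
        refine measure_mono (iUnion₂_subset fun x _ y hy => ?_)
        rw [mem_closedBall_zero_iff]
        exact hy.2.2
    _ = _ := by
        rw [Complex.volume_closedBall, mul_comm, ENNReal.ofReal_mul Real.pi_pos.le,
          ENNReal.ofReal_pow (Real.sqrt_nonneg _), ← NNReal.coe_real_pi,
          ENNReal.ofReal_coe_nnreal]
  rw [hρ2] at h1
  exact (ENNReal.ofReal_le_ofReal_iff (by positivity)).mp h1

/-- Thue's inequality for a disc, with a boundary term. Two points are needed: they force `1 ≤ r`. -/
theorem card_le_of_separated {S : Finset ℂ} {r : ℝ} (hcard : 2 ≤ S.card)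
    (hsep : ∀ x ∈ S, ∀ y ∈ S, x ≠ y → 2 ≤ ‖x - y‖) (hS : ∀ x ∈ S, ‖x‖ ≤ r) :
    (S.card : ℝ) ≤ 1 + Real.pi / √12 * (2 * r + r ^ 2) := by
  obtain ⟨x, hx, y, hy, hne⟩ := Finset.one_lt_card.mp hcard
  have hr : 1 ≤ r := by
    linarith [hsep x hx y hy hne, norm_sub_le x y, hS x hx, hS y hy]
  have h := card_mul_le_of_separated hr hsep hS
  have h3 : (0:ℝ) < √3 := by positivity
  have h12 : √12 = 2 * √3 := by
    rw [show (12 : ℝ) = 2 ^ 2 * 3 by norm_num, Real.sqrt_mul (by norm_num),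
      Real.sqrt_sq (by norm_num)]
  rw [h12, div_mul_eq_mul_div, ← sub_le_iff_le_add', le_div_iff₀ (by positivity)]
  have : 1.732 < √3 := Real.lt_sqrt_of_sq_lt (by norm_num)
  nlinarith [Real.pi_lt_d2]


/-! ### From packing to interference -/

/-- The bound `π/√12 (2b/H + b²/H²)` on the number of points, other than a given one, of a
`2H`-separated configuration in the disc of radius `b`. Its derivative is the weight of the
interference integral. -/
noncomputable def packingBound (H b : ℝ) : ℝ := Real.pi / √12 * (2 * b / H + b ^ 2 / H ^ 2)

theorem card_le_one_add_packingBound {S : Finset Plane} {H b : ℝ} (hH : 0 < H)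
    (hcard : 2 ≤ S.card) (hsep : ∀ x ∈ S, ∀ y ∈ S, x ≠ y → 2 * H ≤ ‖x - y‖)
    (hS : ∀ x ∈ S, ‖x‖ ≤ b) : (S.card : ℝ) ≤ 1 + packingBound H b := by
  let f : Plane → ℂ := fun x => H⁻¹ • Complex.orthonormalBasisOneI.repr.symm x
  have hf : ∀ x, ‖f x‖ = ‖x‖ / H := fun x => by
    rw [norm_smul, LinearIsometryEquiv.norm_map, norm_inv, Real.norm_of_nonneg hH.le,
      inv_mul_eq_div]
  have hfsub : ∀ x y, ‖f x - f y‖ = ‖x - y‖ / H := fun x y => by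
    rw [← hf]; simp only [f, map_sub, smul_sub]
  have hinj : Function.Injective f := fun x y hxy => by
    have := hfsub x y
    rw [hxy, sub_self, norm_zero, eq_comm, div_eq_zero_iff] at this
    exact sub_eq_zero.mp (norm_eq_zero.mp (this.resolve_right hH.ne'))
  have h := card_le_of_separated (S := S.map ⟨f, hinj⟩) (r := b / H)
    (by rwa [Finset.card_map]) ?_ ?_
  · rw [Finset.card_map] at h
    refine h.trans (le_of_eq ?_)
    rw [packingBound, div_pow, mul_div_assoc]
  · simp only [Finset.mem_map, Function.Embedding.coeFn_mk]
    rintro _ ⟨x, hx, rfl⟩ _ ⟨y, hy, rfl⟩ hne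
    rw [hfsub, le_div_iff₀ hH]
    exact hsep x hx y hy fun h => hne (by rw [h])
  · simp only [Finset.mem_map, Function.Embedding.coeFn_mk]
    rintro _ ⟨x, hx, rfl⟩
    rw [hf]
    have := hS x hx
    gcongr

/-- Summation by parts: if at most `M b` of the radii `n i` are at most `b`, then the sum of
`ℓ (n i)` is at most that of a mass `M t` at `t` together with density `M' = m` beyond `t`. The
term `(M b - #F) ℓ b`, for the mass not yet used, carries the induction over increasing radii. -/
theorem sum_antitone_le_integral {ι : Type*} [DecidableEq ι] {ℓ m M : ℝ → ℝ} {n : ι → ℝ} {t : ℝ}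
    (hℓ : AntitoneOn ℓ (Ici t)) (hm : Continuous m) (hm0 : ∀ s, t ≤ s → 0 ≤ m s)
    (hM : ∀ s, HasDerivAt M (m s) s) (hMt : 0 ≤ M t) (F : Finset ι) (hn : ∀ i ∈ F, t ≤ n i)
    (hF : ∀ G ⊆ F, G.Nonempty → ∀ b, (∀ i ∈ G, n i ≤ b) → (G.card : ℝ) ≤ M b)
    {b : ℝ} (htb : t ≤ b) (hb : ∀ i ∈ F, n i ≤ b) :
    ∑ i ∈ F, ℓ (n i) + (M b - F.card) * ℓ b ≤ (∫ s in t..b, ℓ s * m s) + ℓ t * M t := by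
  have hint : ∀ {c d : ℝ}, t ≤ c → c ≤ d → IntervalIntegrable (fun s => ℓ s * m s) volume c d := by
    intro c d hc hd
    refine IntervalIntegrable.mul_continuousOn ?_ hm.continuousOn
    refine AntitoneOn.intervalIntegrable (hℓ.mono ?_)
    rw [uIcc_of_le hd]
    exact fun s hs => hc.trans hs.1
  have step : ∀ (N : ℝ) (A : ℝ) {c d : ℝ}, t ≤ c → c ≤ d → N ≤ M c →
      A + (M c - N) * ℓ c ≤ (∫ s in t..c, ℓ s * m s) + ℓ t * M t →
      A + (M d - N) * ℓ d ≤ (∫ s in t..d, ℓ s * m s) + ℓ t * M t := by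
    intro N A c d hc hd hN h
    rw [← intervalIntegral.integral_add_adjacent_intervals (hint le_rfl hc) (hint hc hd)]
    have h1 : ℓ d * (M d - M c) ≤ ∫ s in c..d, ℓ s * m s := by
      rw [← intervalIntegral.integral_eq_sub_of_hasDerivAt (fun s _ => hM s)
        (hm.intervalIntegrable c d), ← intervalIntegral.integral_const_mul]
      refine intervalIntegral.integral_mono_on hd ((hm.intervalIntegrable c d).const_mul _)
        (hint hc hd) fun s hs => ?_
      exact mul_le_mul_of_nonneg_right (hℓ (hc.trans hs.1) (hc.trans hd) hs.2)
        (hm0 s (hc.trans hs.1))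
    have h2 : (M c - N) * ℓ d ≤ (M c - N) * ℓ c :=
      mul_le_mul_of_nonneg_left (hℓ hc (hc.trans hd) hd) (by linarith)
    nlinarith
  induction F using Finset.induction_on_max_value n generalizing b with
  | empty =>
    refine step _ _ le_rfl htb (by simpa using hMt) ?_
    simp [mul_comm]
  | insert a s ha hmax ih =>
    have hat : t ≤ n a := hn a (Finset.mem_insert_self a s)
    have hsub := Finset.subset_insert a s
    refine step _ _ hat (hb a (Finset.mem_insert_self a s))
      (hF _ subset_rfl (Finset.insert_nonempty a s) _ ?_) ?_
    · intro i hi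
      rcases Finset.mem_insert.mp hi with rfl | hi
      exacts [le_rfl, hmax i hi]
    · have h := ih (fun i hi => hn i (hsub hi)) (fun G hG => hF G (hG.trans hsub)) hat hmax
      rw [Finset.sum_insert ha, Finset.card_insert_of_notMem ha]
      push_cast
      linarith

theorem hasDerivAt_packingBound (H s : ℝ) :
    HasDerivAt (packingBound H) (2 * Real.pi / √12 * (1 / H + s / H ^ 2)) s := by
  have h := ((((hasDerivAt_id s).const_mul 2).div_const H).add
    ((hasDerivAt_pow 2 s).div_const (H ^ 2))).const_mul (Real.pi / √12)
  refine h.congr_deriv ?_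
  simp
  ring

theorem sum_attenuation_le_interferenceBound {ι : Type*} {ℓ : ℝ → ℝ} {n : ι → ℝ}
    {H t : ℝ} (hH : 0 < H) (ht : 0 ≤ t) (hℓ0 : ∀ r, 0 ≤ r → 0 ≤ ℓ r) (hℓ : AntitoneOn ℓ (Ici 0))
    (F : Finset ι) (hn : ∀ i ∈ F, t ≤ n i)
    (hF : ∀ G ⊆ F, G.Nonempty → ∀ b, (∀ i ∈ G, n i ≤ b) → (G.card : ℝ) ≤ packingBound H b) :
    ∑ i ∈ F, ENNReal.ofReal (ℓ (n i)) ≤ interferenceBound ℓ H t := by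
  classical
  obtain ⟨B, hB⟩ := (F.image n).exists_le
  set b := max t B with hbdef
  have htb : t ≤ b := le_max_left _ _
  have hb : ∀ i ∈ F, n i ≤ b := fun i hi =>
    (hB _ (Finset.mem_image_of_mem n hi)).trans (le_max_right _ _)
  have hM0 : ∀ s, 0 ≤ s → 0 ≤ packingBound H s := fun s hs => by
    unfold packingBound; positivity
  have hℓt : AntitoneOn ℓ (Ici t) := hℓ.mono (Ici_subset_Ici.mpr ht)
  have hm : Continuous fun s : ℝ => 2 * Real.pi / √12 * (1 / H + s / H ^ 2) := by fun_prop
  have hm0 : ∀ s, t ≤ s → 0 ≤ 2 * Real.pi / √12 * (1 / H + s / H ^ 2) := fun s hs => by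
    have : 0 ≤ s := ht.trans hs
    positivity
  have h := sum_antitone_le_integral hℓt hm hm0 (hasDerivAt_packingBound H) (hM0 t ht) F hn hF
    htb hb
  have hcard : (F.card : ℝ) ≤ packingBound H b := by
    rcases F.eq_empty_or_nonempty with rfl | hne
    · simpa using hM0 b (ht.trans htb)
    · exact hF F subset_rfl hne b hb
  have hpos : 0 ≤ (packingBound H b - F.card) * ℓ b :=
    mul_nonneg (by linarith) (hℓ0 b (ht.trans htb))
  have hint : IntervalIntegrable (fun s => ℓ s * (2 * Real.pi / √12 * (1 / H + s / H ^ 2)))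
      volume t b := by
    refine IntervalIntegrable.mul_continuousOn (AntitoneOn.intervalIntegrable (hℓt.mono ?_))
      hm.continuousOn
    rw [uIcc_of_le htb]
    exact Icc_subset_Ici_self
  have hI : ENNReal.ofReal (∫ s in t..b, ℓ s * (2 * Real.pi / √12 * (1 / H + s / H ^ 2))) ≤
      ∫⁻ r in Ioi t, ENNReal.ofReal (2 * Real.pi * ℓ r / √12 * (1 / H + r / H ^ 2)) := by
    rw [intervalIntegral.integral_of_le htb, ofReal_integral_eq_lintegral_ofReal hint.1]
    · refine le_trans (le_of_eq ?_) (lintegral_mono_set (Ioc_subset_Ioi_self : Ioc t b ⊆ Ioi t))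
      congr 1 with s
      congr 1
      ring
    · refine (ae_restrict_iff' measurableSet_Ioc).mpr (ae_of_all _ fun s hs => ?_)
      exact mul_nonneg (hℓ0 s (ht.trans hs.1.le)) (hm0 s hs.1.le)
  rw [← ENNReal.ofReal_sum_of_nonneg fun i hi => hℓ0 _ (ht.trans (hn i hi))]
  calc _ ≤ ENNReal.ofReal ((∫ s in t..b, ℓ s * (2 * Real.pi / √12 * (1 / H + s / H ^ 2))) +
        ℓ t * packingBound H t) := ENNReal.ofReal_le_ofReal (by linarith)
    _ ≤ _ := ENNReal.ofReal_add_le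
    _ ≤ _ := by
      refine add_le_add hI (le_of_eq ?_)
      congr 1
      unfold packingBound
      field_simp

theorem exclusionRadius_le_norm {S : Set Plane} {H : ℝ} {x₀ x : Plane}
    (hsep : ∀ x ∈ S, ∀ y ∈ S, x ≠ y → 2 * H ≤ ‖x - y‖) (hx₀ : IsServing S x₀) (hx : x ∈ S)
    (hne : x ≠ x₀) : exclusionRadius H ‖x₀‖ ≤ ‖x‖ :=
  max_le (hx₀.2 x hx) (by linarith [hsep x hx x₀ hx₀.1 hne, norm_sub_le x x₀])

theorem interference_le_interferenceBound {S : Set Plane} {H : ℝ} {x₀ : Plane} {ℓ : ℝ → ℝ}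
    (hH : 0 < H) (hsep : ∀ x ∈ S, ∀ y ∈ S, x ≠ y → 2 * H ≤ ‖x - y‖) (hx₀ : IsServing S x₀)
    (hℓ0 : ∀ r, 0 ≤ r → 0 ≤ ℓ r) (hℓ : AntitoneOn ℓ (Ici 0)) :
    interference ℓ S x₀ ≤ interferenceBound ℓ H (exclusionRadius H ‖x₀‖) := by
  classical
  rw [interference, ENNReal.tsum_eq_iSup_sum]
  refine iSup_le fun F => ?_
  refine sum_attenuation_le_interferenceBound (n := fun x : (S \ {x₀} : Set Plane) => ‖(x : Plane)‖)
    hH ((norm_nonneg x₀).trans (le_max_left _ _)) hℓ0 hℓ F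
    (fun x _ => exclusionRadius_le_norm hsep hx₀ x.2.1 x.2.2) fun G _ hG b hb => ?_
  let T : Finset Plane := insert x₀ (G.map (Function.Embedding.subtype _))
  have hT : T.card = G.card + 1 := by
    rw [Finset.card_insert_of_notMem, Finset.card_map]
    rw [Finset.mem_map]
    rintro ⟨x, -, hx⟩
    exact x.2.2 hx
  have hTmem : ∀ x ∈ T, x ∈ S ∧ ‖x‖ ≤ b := by
    intro x hx
    rcases Finset.mem_insert.mp hx with rfl | hx
    · obtain ⟨g, hg⟩ := hG
      exact ⟨hx₀.1, (hx₀.2 g g.2.1).trans (hb g hg)⟩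
    · obtain ⟨g, hg, rfl⟩ := Finset.mem_map.mp hx
      exact ⟨g.2.1, hb g hg⟩
  have h := card_le_one_add_packingBound (S := T) hH (by rw [hT]; have := hG.card_pos; omega)
    (fun x hx y hy => hsep x (hTmem x hx).1 y (hTmem y hy).1) fun x hx => (hTmem x hx).2
  rw [hT] at h
  push_cast at h
  linarith

theorem theta_le_slotSINR {S : Set Plane} {P W H : ℝ} {x₀ : Plane} {ℓ : ℝ → ℝ}
    (hH : 0 < H) (hW : 0 < W) (hsep : ∀ x ∈ S, ∀ y ∈ S, x ≠ y → 2 * H ≤ ‖x - y‖)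
    (hx₀ : IsServing S x₀) (hℓ0 : ∀ r, 0 ≤ r → 0 ≤ ℓ r) (hℓ : AntitoneOn ℓ (Ici 0)) :
    theta P W ℓ H ‖x₀‖ ≤ slotSINR P W ℓ S x₀ := by
  rw [theta, slotSINR, if_pos hx₀.1]
  -- The noise keeps the quotient finite, so that `toReal` is monotone here.
  apply ENNReal.toReal_mono
  · refine (ENNReal.div_lt_top ENNReal.ofReal_ne_top ?_).ne
    exact ((ENNReal.ofReal_pos.mpr hW).trans_le le_add_self).ne'
  · have := interference_le_interferenceBound hH hsep hx₀ hℓ0 hℓ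
    gcongr

theorem log_le_normalizedRate {K : ℕ} (hK : 0 < K) {P W θ : ℝ} {ℓ : ℝ → ℝ}
    {A : Fin K → Set Plane} {x₀ : Plane} (hθ : 0 ≤ θ)
    (h : ∀ i, θ ≤ slotSINR P W ℓ (A i) x₀) :
    Real.log (1 + θ) ≤ normalizedRate P W ℓ A x₀ := by
  have hK' : (0 : ℝ) < K := Nat.cast_pos.mpr hK
  rw [normalizedRate, one_div, inv_mul_eq_div, le_div_iff₀ hK']
  calc _ = ∑ _i : Fin K, Real.log (1 + θ) := by simp [mul_comm]
    _ ≤ _ := Finset.sum_le_sum fun i _ => Real.log_le_log (by linarith) (by linarith [h i])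

end CellularNetwork

theorem corollary2 {Ω : Type*} [MeasurableSpace Ω] (μ : MeasureTheory.Measure Ω)
    [MeasureTheory.IsProbabilityMeasure μ]
    (Φ : CellularNetwork.PointProcess Ω) (H : ℝ) (hH : 0 < H)
    (hΦ : Φ.IsHardcoreRegulated μ H)
    (P W : ℝ) (hP : 0 < P) (hW : 0 < W)
    (ℓ : ℝ → ℝ) (hℓ_nonneg : ∀ r : ℝ, 0 ≤ r → 0 ≤ ℓ r) (hℓ_anti : AntitoneOn ℓ (Set.Ici 0))
    (K : ℕ) (hK : 0 < K) :
    ∀ᵐ ω ∂μ, ∀ x₀ : CellularNetwork.Plane, CellularNetwork.IsServing (Φ.points ω) x₀ →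
      ∀ d : ℝ, ‖x₀‖ = d →
        (∀ i : Fin K,
          CellularNetwork.theta P W ℓ H d ≤
            CellularNetwork.slotSINR P W ℓ
              (CellularNetwork.alwaysActive K (Φ.points ω) i) x₀) ∧
        Real.log (1 + CellularNetwork.theta P W ℓ H d) ≤
          CellularNetwork.normalizedRate P W ℓ
            (CellularNetwork.alwaysActive K (Φ.points ω)) x₀ := by
  filter_upwards [hΦ.2] with ω hω
  rintro x₀ hx₀ d rfl
  have h : ∀ i : Fin K, CellularNetwork.theta P W ℓ H ‖x₀‖ ≤
      CellularNetwork.slotSINR P W ℓ (CellularNetwork.alwaysActive K (Φ.points ω) i) x₀ :=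
    fun _ => CellularNetwork.theta_le_slotSINR hH hW hω hx₀ hℓ_nonneg hℓ_anti
  exact ⟨h, CellularNetwork.log_le_normalizedRate hK ENNReal.toReal_nonneg h⟩
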